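/- Let $Z=(Z_t)_{t\ge 0}$, with laws $(\mathbb P_x)$, be a continuous-state branching process (a $[0,\infty)$-valued time-homogeneous strong Markov process with càdlàg paths, $\mathbb P_x(Z_0=x)=1$, absorbed at $0$, and such that $\mathbb P_{x+y}[e^{-\lambda Z_t}]=\mathbb P_x[e^{-\lambda Z_t}]\,\mathbb P_y[e^{-\lambda Z_t}]$ for all $\lambda\ge 0$, $x,y>0$, $t\ge 0$) with branching mechanism $$\psi(\lambda)=\alpha\lambda+\tfrac12\sigma^2\lambda^2+\int_{(0,\infty)}\left(e^{-\lambda r}-1+\lambda r\right)\pi(dr),\qquad \lambda\ge 0,$$ where $\alpha\ge 0$, $\sigma\ge 0$, and $\pi$ is a measure on $(0,\infty)$ with $\int_{(0,\infty)} (r\wedge r^2)\,\pi(dr)<\infty$; that is, $\mathbb P_x[e^{-\lambda Z_t}]=e^{-xu_t(\lambda)}$ for $\lambda,x>0$, $t\ge 0$, where $\partial_t u_t(\lambda)=-\psi(u_t(\lambda))$ and $u_0(\lambda)=\lambda$. Assume that $\int^{\infty}\frac{d\lambda}{\psi(\lambda)}<\infty$. (Throughout, $\int^\infty f(s)\,ds<\infty$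 means that $\int_a^\infty f(s)\,ds<\infty$ for some $a>0$, with the convention $1/0=\infty$.) Let $G(x,A)=\int_0^\infty \mathbb P_x(Z_t\in A)\,dt$, for Borel sets $A\subset(0,\infty)$, be the potential measure of $Z$ on $(0,\infty)$. (a) If $\alpha>0$, then $G(x,dy)$ is a finite measure on $(0,\infty)$ for every $x>0$. (b) If $\alpha=0$, then the following four statements are equivalent: (1) $G(x,dy)$ is a finite measure on $(0,\infty)$ for some $x>0$; (2) $G(x,dy)$ is a finite measure on $(0,\infty)$ for every $x>0$; (3) $\displaystyle\int^{\infty}\frac{ds}{s\int_0^s\bar{\bar\pi}(r)\,dr}<\infty$, where $\bar\pi(r)=\pi((r,\infty))$ and $\bar{\bar\pi}(r)=\int_r^\infty\bar\pi(y)\,dy$; (4) $\displaystyle\int^{\infty}\frac{ds}{s\int_{(0,s]}r^2\,\pi(dr)+s^2\int_{(s,\infty)}r\,\pi(dr)}<\infty$. -/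

import Mathlib

open MeasureTheory ProbabilityTheory Set Filter Topology
open scoped NNReal ENNReal

noncomputable section

/-- The branching mechanism
`ψ(u) = α u + σ² u² / 2 + ∫_{(0,∞)} (e^{-u r} - 1 + u r) π(dr)`, for `u ≥ 0`. -/
def branchingMechanism (α σ : ℝ) (π : Measure ℝ) (u : ℝ) : ℝ :=
  α * u + σ ^ 2 * u ^ 2 / 2 + ∫ r in Ioi (0 : ℝ), (Real.exp (-u * r) - 1 + u * r) ∂π

/-- `π` is a measure on `(0,∞)` with `∫ (r ∧ r²) π(dr) < ∞` (in particular `π` is Radon on `(0,∞)`). -/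
structure IsBranchingLevyMeasure (π : Measure ℝ) : Prop where
  concentrated : π (Iic 0) = 0
  moment : ∫⁻ r in Ioi (0 : ℝ), ENNReal.ofReal (min r (r ^ 2)) ∂π < ∞

/-- `∫^{+∞} f(s) ds < ∞`: the integral of the nonnegative function `f` converges at `+∞`. -/
def IntegralFiniteAtTop (f : ℝ → ℝ≥0∞) : Prop :=
  ∃ a : ℝ, 0 < a ∧ ∫⁻ s in Ioi a, f s < ∞

/-- Grey's condition `∫^{+∞} du / ψ(u) < ∞`. The inverse is taken in `[0,∞]`, so `1/0 = ∞`. -/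
def GreyCondition (ψ : ℝ → ℝ) : Prop :=
  IntegralFiniteAtTop fun u => (ENNReal.ofReal (ψ u))⁻¹

/-- `Z`, under the family of laws `(P x)` indexed by the starting point `x`, is a continuous-state
branching process: a `[0,∞)`-valued time-homogeneous strong Markov process with càdlàg paths,
absorbed at `0` and satisfying the branching property. -/
structure IsCBProcess {Ω : Type*} [MeasurableSpace Ω] (P : Kernel ℝ≥0 Ω) (Z : ℝ≥0 → Ω → ℝ≥0) :
    Prop where
  isMarkovKernel : IsMarkovKernel P
  stronglyMeasurable : ∀ t, StronglyMeasurable (Z t)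
  right_continuous : ∀ ω t, ContinuousWithinAt (fun s => Z s ω) (Ici t) t
  left_limits : ∀ ω t, ∃ l : ℝ≥0, Tendsto (fun s => Z s ω) (𝓝[<] t) (𝓝 l)
  initial : ∀ x, ∀ᵐ ω ∂P x, Z 0 ω = x
  absorbing : ∀ t, ∀ᵐ ω ∂P 0, Z t ω = 0
  /-- For a stopping time `τ` of the natural filtration, the law of `Z (τ + t)` given the past
  up to `τ`, on `τ < ∞`, is that of `Z t` under `P (Z τ)`. -/
  strong_markov : ∀ (τ : Ω → WithTop ℝ≥0)
    (hτ : IsStoppingTime (Filtration.natural Z stronglyMeasurable) τ)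
    (x t : ℝ≥0) (A : Set Ω) (B : Set ℝ≥0), MeasurableSet[hτ.measurableSpace] A → MeasurableSet B →
    P x (A ∩ {ω | τ ω ≠ ⊤} ∩ {ω | Z ((τ ω).untopD 0 + t) ω ∈ B}) =
      ∫⁻ ω in A ∩ {ω | τ ω ≠ ⊤}, P (Z ((τ ω).untopD 0) ω) (Z t ⁻¹' B) ∂P x
  branching : ∀ (l : ℝ) (x y t : ℝ≥0), 0 ≤ l → 0 < x → 0 < y →
    ∫ ω, Real.exp (-l * Z t ω) ∂P (x + y) =
      (∫ ω, Real.exp (-l * Z t ω) ∂P x) * ∫ ω, Real.exp (-l * Z t ω) ∂P y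

/-- `v : [0,∞) → [0,∞)` solves `v' = -ψ(v)`, `v(0) = l`. -/
structure IsCumulantSolution (ψ : ℝ → ℝ) (l : ℝ) (v : ℝ → ℝ) : Prop where
  initial : v 0 = l
  nonneg : ∀ t, 0 ≤ t → 0 ≤ v t
  ode : ∀ t, 0 ≤ t → HasDerivWithinAt v (-ψ (v t)) (Ici 0) t

/-- The process `Z` has branching mechanism `ψ`: for all `l > 0`, `x > 0` and `t ≥ 0`,
`P_x[exp(-l Z_t)] = exp(-x u_t(l))`, where `t ↦ u_t(l)` solves `∂_t u = -ψ(u)`, `u_0(l) = l`. -/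
def HasBranchingMechanism {Ω : Type*} [MeasurableSpace Ω] (P : Kernel ℝ≥0 Ω)
    (Z : ℝ≥0 → Ω → ℝ≥0) (ψ : ℝ → ℝ) : Prop :=
  ∀ l : ℝ, 0 < l → ∃ v : ℝ → ℝ, IsCumulantSolution ψ l v ∧
    ∀ x t : ℝ≥0, 0 < x → ∫ ω, Real.exp (-l * Z t ω) ∂P x = Real.exp (-x * v t)

theorem exists_grid_approx : ∃ (c : ℕ → ℕ → ℝ≥0) (g : ℕ → ℝ≥0 → ℕ), (∀ n, Measurable (g n)) ∧
    (∀ n t, t ≤ c n (g n t)) ∧ ∀ t, Tendsto (fun n => c n (g n t)) atTop (𝓝 t) := by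
  have hlow : ∀ (n : ℕ) (t : ℝ≥0),
      t ≤ (((⌊((n : ℝ≥0) + 1) * t⌋₊ : ℕ) : ℝ≥0) + 1) / ((n : ℝ≥0) + 1) := by
    intro n t
    rw [le_div_iff₀ (by positivity), mul_comm]
    exact (Nat.lt_floor_add_one _).le
  have hup : ∀ (n : ℕ) (t : ℝ≥0),
      (((⌊((n : ℝ≥0) + 1) * t⌋₊ : ℕ) : ℝ≥0) + 1) / ((n : ℝ≥0) + 1) ≤
        t + 1 / ((n : ℝ≥0) + 1) := by
    intro n t
    rw [add_div]
    gcongr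
    rw [div_le_iff₀ (by positivity), mul_comm t]
    exact Nat.floor_le (by positivity)
  refine ⟨fun n k => ((k : ℝ≥0) + 1) / ((n : ℝ≥0) + 1), fun n t => ⌊((n : ℝ≥0) + 1) * t⌋₊,
    fun n => Nat.measurable_floor.comp (measurable_id.const_mul _), hlow, fun t => ?_⟩
  have hlim : Tendsto (fun n : ℕ => t + 1 / ((n : ℝ≥0) + 1)) atTop (𝓝 t) := by
    simpa using tendsto_const_nhds.add (tendsto_one_div_add_atTop_nhds_zero_nat (𝕜 := ℝ≥0))
  exact tendsto_of_tendsto_of_tendsto_of_le_of_le tendsto_const_nhds hlim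
    (fun n => hlow n t) (fun n => hup n t)

theorem IsCBProcess.measurable_uncurry {Ω : Type*} [MeasurableSpace Ω] {P : Kernel ℝ≥0 Ω}
    {Z : ℝ≥0 → Ω → ℝ≥0} (h : IsCBProcess P Z) :
    Measurable (fun p : ℝ × Ω => Z p.1.toNNReal p.2) := by
  obtain ⟨c, g, hg, hlow, hT⟩ := exists_grid_approx
  have key : Measurable (fun p : ℝ≥0 × Ω => Z p.1 p.2) := by
    refine measurable_of_tendsto_metrizable
      (f := fun (n : ℕ) (p : ℝ≥0 × Ω) => Z (c n (g n p.1)) p.2) (fun n => ?_) ?_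
    · have h1 : Measurable (fun q : ℕ × Ω => Z (c n q.1) q.2) :=
        measurable_from_prod_countable_right fun k => (h.stronglyMeasurable (c n k)).measurable
      exact h1.comp (((hg n).comp measurable_fst).prodMk measurable_snd)
    · rw [tendsto_pi_nhds]
      rintro ⟨t, ω⟩
      exact (h.right_continuous ω t).tendsto.comp
        (tendsto_nhdsWithin_iff.2 ⟨hT t, Eventually.of_forall fun n => hlow n t⟩)
  exact key.comp ((measurable_real_toNNReal.comp measurable_fst).prodMk measurable_snd)

theorem IsCBProcess.measurable_time {Ω : Type*} [MeasurableSpace Ω] {P : Kernel ℝ≥0 Ω}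
    {Z : ℝ≥0 → Ω → ℝ≥0} (h : IsCBProcess P Z) (x : ℝ≥0) {A : Set ℝ≥0} (hA : MeasurableSet A) :
    Measurable (fun t : ℝ => P x (Z t.toNNReal ⁻¹' A)) := by
  have := h.isMarkovKernel
  exact measurable_measure_prodMk_left (ν := P x) (h.measurable_uncurry hA)

/-- The potential measure `G(x, A) = ∫_0^∞ P_x(Z_t ∈ A) dt`, for `A` a Borel subset of `(0,∞)`,
as a measure on `[0,∞)` that does not charge `0`. -/
def potentialMeasure {Ω : Type*} [MeasurableSpace Ω] {P : Kernel ℝ≥0 Ω}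
    {Z : ℝ≥0 → Ω → ℝ≥0} (h : IsCBProcess P Z) (x : ℝ≥0) : Measure ℝ≥0 :=
  (Measure.ofMeasurable (fun A _ => ∫⁻ t in Ioi (0 : ℝ), P x (Z t.toNNReal ⁻¹' A)) (by simp)
    (by
      intro f hf hd
      rw [← lintegral_tsum fun i => (h.measurable_time x (hf i)).aemeasurable]
      refine lintegral_congr fun t => ?_
      rw [preimage_iUnion, measure_iUnion]
      · exact fun i j hij => (hd hij).preimage _
      · exact fun i => (h.stronglyMeasurable _).measurable (hf i))).restrict (Ioi 0)

theorem potentialMeasure_apply {Ω : Type*} [MeasurableSpace Ω] {P : Kernel ℝ≥0 Ω}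
    {Z : ℝ≥0 → Ω → ℝ≥0} (h : IsCBProcess P Z) (x : ℝ≥0) {A : Set ℝ≥0} (hA : MeasurableSet A)
    (hA0 : A ⊆ Ioi 0) :
    potentialMeasure h x A = ∫⁻ t in Ioi (0 : ℝ), P x (Z t.toNNReal ⁻¹' A) := by
  rw [potentialMeasure, Measure.restrict_apply hA, inter_eq_left.2 hA0,
    Measure.ofMeasurable_apply A hA]

/-- The tail `π̄(r) = π((r,∞))`. -/
def levyTail (π : Measure ℝ) (r : ℝ) : ℝ≥0∞ := π (Ioi r)

/-- The integrated tail `∫_r^∞ π̄(y) dy`. -/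
def levyIntegratedTail (π : Measure ℝ) (r : ℝ) : ℝ≥0∞ := ∫⁻ y in Ioi r, levyTail π y

end

/-! The total mass of the potential measure is explicit (`potentialMeasure_univ_eq`): G(x,(0,∞)) =
∫_0^∞ (1 - e^{-xu}) / ψ(u) du. Indeed P_x(Z_t > 0) is the increasing limit in λ of 1 - e^{-x
u_t(λ)}, and since du = -ψ(u) dt, the map t ↦ u_t(λ) carries (0,∞) onto (0,λ). Grey's condition
makes ψ positive and controls the integral at infinity, so finiteness depends only on ∫_0 u/ψ(u) du,
whatever x is (`isFiniteMeasure_potentialMeasure_iff`).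

If α > 0, then ψ(u) ≥ αu and the integrand is bounded. If α = 0, put u = 1/s: the integral becomes
∫^∞ ds / (s · s²ψ(1/s)). As e^{-z} - 1 + z is comparable to z ∧ z², s²ψ(1/s) is comparable to σ²/2 +
M(s), where M(s) = ∫ (r² ∧ sr) π(dr). Since M is nondecreasing, σ²/2 can be absorbed unless M(1) =
0, and in that case the integral diverges. Finally s·M(s) is exactly the denominator in (4), and
agrees with the one in (3) up to a factor 4. -/

/-! ### Elementary bounds for e^{-z} - 1 + z -/

theorem exp_neg_sub_one_add_nonneg (z : ℝ) : 0 ≤ Real.exp (-z) - 1 + z := by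
  linarith [Real.add_one_le_exp (-z)]

/-- The quadratic bound comes from e^{-z} ≤ 1/(1+z) ≤ 1 - z + z². -/
theorem exp_neg_sub_one_add_le_min {z : ℝ} (hz : 0 ≤ z) :
    Real.exp (-z) - 1 + z ≤ min z (z ^ 2) := by
  refine le_min (by linarith [Real.exp_le_one_iff.2 (neg_nonpos.2 hz)]) ?_
  have h1 : Real.exp (-z) * (1 + z) ≤ 1 := by
    calc Real.exp (-z) * (1 + z) ≤ Real.exp (-z) * Real.exp z := by
          gcongr; linarith [Real.add_one_le_exp z]
      _ = 1 := by rw [← Real.exp_add]; simp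
  have h2 : Real.exp (-z) ≤ 1 / (1 + z) := by rwa [le_div_iff₀ (by positivity)]
  have h3 : 1 / (1 + z) ≤ 1 - z + z ^ 2 := by
    rw [div_le_iff₀ (by positivity)]
    nlinarith [pow_nonneg hz 3]
  linarith

/-- For z ≤ 2, squaring 1 - z/2 ≤ e^{-z/2} leaves z²/4; for z ≥ 2 the linear part z - 1 suffices. -/
theorem min_le_exp_neg_sub_one_add (z : ℝ) :
    min z (z ^ 2) ≤ 4 * (Real.exp (-z) - 1 + z) := by
  rcases le_total z 2 with h | h
  · have h1 : (1 - z / 2) ^ 2 ≤ Real.exp (-(z / 2)) ^ 2 :=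
      pow_le_pow_left₀ (by linarith) (Real.one_sub_le_exp_neg _) 2
    rw [← Real.exp_nat_mul] at h1
    have h2 : ((2 : ℕ) : ℝ) * -(z / 2) = -z := by push_cast; ring
    rw [h2] at h1
    exact (min_le_right _ _).trans (by nlinarith)
  · exact (min_le_left _ _).trans (by linarith [Real.exp_pos (-z)])

/-- Convexity of exp on the segment from -z to 0. -/
theorem exp_neg_sub_one_add_mul_le {t : ℝ} (ht0 : 0 ≤ t) (ht1 : t ≤ 1) (z : ℝ) :
    Real.exp (-(t * z)) - 1 + t * z ≤ t * (Real.exp (-z) - 1 + z) := by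
  have := convexOn_exp.2 (mem_univ (-z)) (mem_univ 0) ht0 (sub_nonneg.2 ht1) (by ring)
  simp only [smul_eq_mul, mul_zero, add_zero, Real.exp_zero, mul_one, mul_neg] at this
  linarith

theorem min_mul_le {u r : ℝ} (hu : 0 ≤ u) (hr : 0 ≤ r) :
    min (u * r) ((u * r) ^ 2) ≤ (u + u ^ 2) * min r (r ^ 2) := by
  rcases le_total r (r ^ 2) with h | h
  · rw [min_eq_left h]
    exact (min_le_left _ _).trans (by nlinarith [mul_nonneg (sq_nonneg u) hr])
  · rw [min_eq_right h]
    exact (min_le_right _ _).trans (by nlinarith [mul_nonneg hu (sq_nonneg r)])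

/-! ### Growth and positivity of the branching mechanism -/

namespace IsBranchingLevyMeasure

variable {π : Measure ℝ} {α σ : ℝ}

theorem ae_pos (hπ : IsBranchingLevyMeasure π) : ∀ᵐ r ∂π, 0 < r := by
  rw [ae_iff]
  simp only [not_lt]
  exact hπ.concentrated

theorem restrict_Ioi (hπ : IsBranchingLevyMeasure π) : π.restrict (Ioi 0) = π :=
  Measure.restrict_eq_self_of_ae_mem hπ.ae_pos

/-- The density r ∧ r² is positive π-a.e. and turns π into a finite measure, from which π is
recovered by the inverse density. This is what permits Tonelli for the integrated tail. -/
theorem sigmaFinite (hπ : IsBranchingLevyMeasure π) : SigmaFinite π := by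
  set f : ℝ → ℝ≥0∞ := fun r => ENNReal.ofReal (min r (r ^ 2)) with hf
  have hm : Measurable f := by fun_prop
  have h0 : ∀ᵐ r ∂π, f r ≠ 0 := by
    filter_upwards [hπ.ae_pos] with r hr
    simp [hf, hr, hr.ne']
  have hfin : IsFiniteMeasure (π.withDensity f) :=
    isFiniteMeasure_withDensity (by simpa only [hπ.restrict_Ioi] using hπ.moment.ne)
  rw [← withDensity_inv_same hm h0 (Eventually.of_forall fun r => ENNReal.ofReal_ne_top)]
  refine SigmaFinite.withDensity_of_ne_top ?_
  filter_upwards [(withDensity_absolutelyContinuous π f) h0] with r hr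
  exact ENNReal.inv_ne_top.2 hr

theorem integrable_exp (hπ : IsBranchingLevyMeasure π) {u : ℝ} (hu : 0 ≤ u) :
    Integrable (fun r => Real.exp (-u * r) - 1 + u * r) (π.restrict (Ioi 0)) := by
  have h1 : Integrable (fun r : ℝ => min r (r ^ 2)) (π.restrict (Ioi 0)) := by
    refine ⟨by fun_prop, ?_⟩
    rw [hasFiniteIntegral_iff_ofReal]
    · exact hπ.moment
    · filter_upwards [ae_restrict_mem measurableSet_Ioi] with r hr
      exact le_min (le_of_lt hr) (sq_nonneg r)
  refine (h1.const_mul (u + u ^ 2)).mono' (by fun_prop) ?_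
  filter_upwards [ae_restrict_mem measurableSet_Ioi] with r hr
  have hr : 0 < r := hr
  rw [neg_mul, Real.norm_of_nonneg (exp_neg_sub_one_add_nonneg _)]
  exact (exp_neg_sub_one_add_le_min (by positivity)).trans (min_mul_le hu hr.le)

theorem branchingMechanism_nonneg (hα : 0 ≤ α) {u : ℝ} (hu : 0 ≤ u) :
    0 ≤ branchingMechanism α σ π u := by
  unfold branchingMechanism
  have : 0 ≤ ∫ r in Ioi (0 : ℝ), (Real.exp (-u * r) - 1 + u * r) ∂π :=
    integral_nonneg fun r => by
      rw [neg_mul]; exact exp_neg_sub_one_add_nonneg _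
  positivity

theorem mul_le_branchingMechanism {u : ℝ} : α * u ≤ branchingMechanism α σ π u := by
  unfold branchingMechanism
  have : 0 ≤ ∫ r in Ioi (0 : ℝ), (Real.exp (-u * r) - 1 + u * r) ∂π :=
    integral_nonneg fun r => by
      rw [neg_mul]; exact exp_neg_sub_one_add_nonneg _
  have : 0 ≤ σ ^ 2 * u ^ 2 / 2 := by positivity
  linarith

theorem branchingMechanism_mul_le (hπ : IsBranchingLevyMeasure π) {t : ℝ} (ht0 : 0 ≤ t)
    (ht1 : t ≤ 1) {u : ℝ} (hu : 0 ≤ u) :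
    branchingMechanism α σ π (t * u) ≤ t * branchingMechanism α σ π u := by
  unfold branchingMechanism
  have h : ∫ r in Ioi (0 : ℝ), (Real.exp (-(t * u) * r) - 1 + t * u * r) ∂π ≤
      t * ∫ r in Ioi (0 : ℝ), (Real.exp (-u * r) - 1 + u * r) ∂π := by
    rw [← integral_const_mul]
    refine integral_mono (hπ.integrable_exp (by positivity))
      ((hπ.integrable_exp hu).const_mul t) fun r => ?_
    simp only [neg_mul, mul_assoc]
    exact exp_neg_sub_one_add_mul_le ht0 ht1 (u * r)
  have h2 : σ ^ 2 * (t * u) ^ 2 / 2 ≤ t * (σ ^ 2 * u ^ 2 / 2) := by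
    have : 0 ≤ t * (1 - t) * (σ ^ 2 * u ^ 2) :=
      mul_nonneg (mul_nonneg ht0 (sub_nonneg.2 ht1)) (by positivity)
    nlinarith
  linarith

/-- The graph of ψ on [0,l] lies below its chord from the origin; this linear bound keeps the
solutions of v' = -ψ(v) away from 0. -/
theorem branchingMechanism_le_div_mul (hπ : IsBranchingLevyMeasure π) {u l : ℝ} (hu : 0 ≤ u)
    (hl : 0 < l) (hul : u ≤ l) :
    branchingMechanism α σ π u ≤ branchingMechanism α σ π l / l * u := by
  have := hπ.branchingMechanism_mul_le (α := α) (σ := σ) (div_nonneg hu hl.le)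
    ((div_le_one hl).2 hul) hl.le
  rw [div_mul_cancel₀ _ hl.ne'] at this
  exact this.trans_eq (by ring)

theorem branchingMechanism_mono (hπ : IsBranchingLevyMeasure π) (hα : 0 ≤ α) {u l : ℝ}
    (hu : 0 ≤ u) (hl : 0 < l) (hul : u ≤ l) :
    branchingMechanism α σ π u ≤ branchingMechanism α σ π l := by
  refine (hπ.branchingMechanism_le_div_mul hu hl hul).trans ?_
  rw [div_mul_eq_mul_div, div_le_iff₀ hl]
  exact mul_le_mul_of_nonneg_left hul (branchingMechanism_nonneg hα hl.le)

/-- Scaling z by t ≥ 1 multiplies z ∧ z² by at most t². The bound serves to propagate a zero of ψ to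
all larger arguments. -/
theorem branchingMechanism_mul_le_sq (hπ : IsBranchingLevyMeasure π) (hα : 0 ≤ α) {t : ℝ}
    (ht : 1 ≤ t) {u : ℝ} (hu : 0 ≤ u) :
    branchingMechanism α σ π (t * u) ≤ 4 * t ^ 2 * branchingMechanism α σ π u := by
  unfold branchingMechanism
  have ht2 : t ≤ t ^ 2 := by nlinarith
  have h : ∫ r in Ioi (0 : ℝ), (Real.exp (-(t * u) * r) - 1 + t * u * r) ∂π ≤
      4 * t ^ 2 * ∫ r in Ioi (0 : ℝ), (Real.exp (-u * r) - 1 + u * r) ∂π := by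
    rw [← integral_const_mul]
    refine integral_mono_ae (hπ.integrable_exp (by positivity))
      ((hπ.integrable_exp hu).const_mul _) ?_
    filter_upwards [ae_restrict_mem measurableSet_Ioi] with r hr
    have hr : 0 < r := hr
    have hz : 0 ≤ u * r := by positivity
    simp only [neg_mul, mul_assoc t]
    refine (exp_neg_sub_one_add_le_min (by positivity)).trans ?_
    have h1 : min (t * (u * r)) ((t * (u * r)) ^ 2) ≤ t ^ 2 * min (u * r) ((u * r) ^ 2) := by
      rw [mul_min_of_nonneg _ _ (sq_nonneg t), mul_pow]
      exact min_le_min_right _ (mul_le_mul_of_nonneg_right ht2 hz)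
    nlinarith [min_le_exp_neg_sub_one_add (u * r), sq_nonneg t]
  have h2 : α * (t * u) ≤ 4 * t ^ 2 * (α * u) := by
    have : 0 ≤ α * u := by positivity
    nlinarith
  have h3 : 0 ≤ σ ^ 2 * (t * u) ^ 2 := by positivity
  nlinarith

/-- If ψ(u) ≤ 0 for one u > 0, then ψ ≤ 0 on [u,∞), so 1/ψ = ∞ there, against Grey's condition. -/
theorem branchingMechanism_pos (hπ : IsBranchingLevyMeasure π) (hα : 0 ≤ α)
    (hGrey : GreyCondition (branchingMechanism α σ π)) {u : ℝ} (hu : 0 < u) :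
    0 < branchingMechanism α σ π u := by
  by_contra hneg
  obtain ⟨a, ha, hfin⟩ := hGrey
  have hzero : ∀ l, u ≤ l → branchingMechanism α σ π l ≤ 0 := by
    intro l hl
    have := hπ.branchingMechanism_mul_le_sq (σ := σ) hα ((one_le_div hu).2 hl) hu.le
    rw [div_mul_cancel₀ _ hu.ne'] at this
    exact this.trans (mul_nonpos_of_nonneg_of_nonpos (by positivity) (not_lt.1 hneg))
  have h1 : ∫⁻ _ in Ioi (max a u), (∞ : ℝ≥0∞) ≤
      ∫⁻ s in Ioi a, (ENNReal.ofReal (branchingMechanism α σ π s))⁻¹ := by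
    refine (setLIntegral_mono' measurableSet_Ioi fun s hs => ?_).trans
      (lintegral_mono_set (Ioi_subset_Ioi (le_max_left a u)))
    rw [ENNReal.ofReal_of_nonpos (hzero s ((le_max_right a u).trans (le_of_lt hs))),
      ENNReal.inv_zero]
  simp only [lintegral_const, Measure.restrict_apply MeasurableSet.univ, univ_inter,
    Real.volume_Ioi, ENNReal.top_mul_top, top_le_iff] at h1
  exact hfin.ne h1

end IsBranchingLevyMeasure

/-! ### The cumulant equation as a change of variables -/

namespace IsCumulantSolution

variable {ψ : ℝ → ℝ} {l : ℝ} {v : ℝ → ℝ}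

theorem continuousOn (hv : IsCumulantSolution ψ l v) : ContinuousOn v (Ici 0) :=
  fun t ht => (hv.ode t ht).continuousWithinAt

theorem hasDerivAt (hv : IsCumulantSolution ψ l v) {t : ℝ} (ht : 0 < t) :
    HasDerivAt v (-ψ (v t)) t :=
  (hv.ode t ht.le).hasDerivAt (Ici_mem_nhds ht)

theorem le_initial (hv : IsCumulantSolution ψ l v) (hψ : ∀ u, 0 ≤ u → 0 ≤ ψ u) {t : ℝ}
    (ht : 0 ≤ t) : v t ≤ l := by
  have : AntitoneOn v (Ici 0) := by
    refine antitoneOn_of_deriv_nonpos (convex_Ici 0) hv.continuousOn ?_ ?_ <;>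
      rw [interior_Ici]
    · exact fun s hs => (hv.hasDerivAt hs).differentiableAt.differentiableWithinAt
    · intro s hs
      rw [(hv.hasDerivAt hs).deriv, neg_nonpos]
      exact hψ _ (hv.nonneg s (le_of_lt hs))
  exact (this self_mem_Ici ht ht).trans_eq hv.initial

/-- Grönwall: v(t) e^{Ct} is nondecreasing, because v stays in [0,l], where ψ(u) ≤ Cu. -/
theorem pos (hv : IsCumulantSolution ψ l v) (hl : 0 < l) (hψ : ∀ u, 0 ≤ u → 0 ≤ ψ u) {C : ℝ}
    (hC : ∀ u, 0 ≤ u → u ≤ l → ψ u ≤ C * u) {t : ℝ} (ht : 0 ≤ t) : 0 < v t := by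
  have hder : ∀ s, 0 < s → HasDerivAt (fun s => v s * Real.exp (C * s))
      (-ψ (v s) * Real.exp (C * s) + v s * (Real.exp (C * s) * (C * 1))) s := fun s hs =>
    (hv.hasDerivAt hs).mul ((hasDerivAt_id s).const_mul C).exp
  have hmono : MonotoneOn (fun s => v s * Real.exp (C * s)) (Ici 0) := by
    refine monotoneOn_of_deriv_nonneg (convex_Ici 0)
      (hv.continuousOn.mul (by fun_prop)) ?_ ?_ <;> rw [interior_Ici]
    · exact fun s hs => (hder s hs).differentiableAt.differentiableWithinAt
    · intro s hs
      have hs : 0 < s := hs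
      rw [(hder s hs).deriv]
      have := hC (v s) (hv.nonneg s hs.le) (hv.le_initial hψ hs.le)
      nlinarith [Real.exp_pos (C * s)]
  have h := hmono self_mem_Ici ht ht
  simp only [hv.initial, mul_zero, Real.exp_zero, mul_one] at h
  exact pos_of_mul_pos_left (hl.trans_le h) (Real.exp_pos _).le

theorem strictAntiOn (hv : IsCumulantSolution ψ l v) (hpos : ∀ t, 0 ≤ t → 0 < v t)
    (hψ : ∀ u, 0 < u → 0 < ψ u) : StrictAntiOn v (Ici 0) := by
  refine strictAntiOn_of_deriv_neg (convex_Ici 0) hv.continuousOn ?_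
  rw [interior_Ici]
  intro s hs
  have hs : 0 < s := hs
  rw [(hv.hasDerivAt hs).deriv]
  exact neg_lt_zero.2 (hψ _ (hpos s hs.le))

theorem exists_lt (hv : IsCumulantSolution ψ l v) (hψ : ∀ u, 0 < u → 0 < ψ u)
    (hmono : ∀ u w, 0 < u → u ≤ w → ψ u ≤ ψ w) {y : ℝ} (hy : 0 < y) :
    ∃ t, 0 ≤ t ∧ v t < y := by
  by_contra! hcon
  -- As long as v ≥ y its slope is at most -ψ(y), so by this time v would have fallen to l - (|l| +
  -- 1) < 0.
  have hT : 0 ≤ (|l| + 1) / ψ y := by have := hψ y hy; positivity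
  have := (convex_Ici (0 : ℝ)).image_sub_le_mul_sub_of_deriv_le (C := -ψ y) hv.continuousOn
    (by
      rw [interior_Ici]
      exact fun s hs => (hv.hasDerivAt hs).differentiableAt.differentiableWithinAt)
    (by
      rw [interior_Ici]
      intro s hs
      have hs : 0 < s := hs
      rw [(hv.hasDerivAt hs).deriv, neg_le_neg_iff]
      exact hmono _ _ hy (hcon s hs.le)) 0 self_mem_Ici _ hT hT
  rw [hv.initial, sub_zero, neg_mul, mul_div_cancel₀ _ (hψ y hy).ne'] at this
  linarith [hv.nonneg _ hT, le_abs_self l]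

theorem image_Ioi (hv : IsCumulantSolution ψ l v) (hpos : ∀ t, 0 ≤ t → 0 < v t)
    (hψ : ∀ u, 0 < u → 0 < ψ u) (hmono : ∀ u w, 0 < u → u ≤ w → ψ u ≤ ψ w) :
    v '' Ioi 0 = Ioo 0 l := by
  have hanti := hv.strictAntiOn hpos hψ
  ext y
  constructor
  · rintro ⟨t, ht, rfl⟩
    have ht : 0 < t := ht
    exact ⟨hpos t ht.le, (hanti self_mem_Ici ht.le ht).trans_eq hv.initial⟩
  · rintro ⟨hy0, hyl⟩
    obtain ⟨T, hT, hvT⟩ := hv.exists_lt hψ hmono hy0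
    obtain ⟨t, ht, rfl⟩ := intermediate_value_Icc' hT
      (hv.continuousOn.mono Icc_subset_Ici_self) ⟨hvT.le, by rw [hv.initial]; exact hyl.le⟩
    refine ⟨t, lt_of_le_of_ne ht.1 ?_, rfl⟩
    rintro rfl
    exact hyl.ne hv.initial

/-- Substitution u = v(t), whose Jacobian ψ(v(t)) cancels 1/ψ; injectivity of v makes any
measurability of f unnecessary. -/
theorem lintegral_comp (hv : IsCumulantSolution ψ l v) (hpos : ∀ t, 0 ≤ t → 0 < v t)
    (hψ : ∀ u, 0 < u → 0 < ψ u) (hmono : ∀ u w, 0 < u → u ≤ w → ψ u ≤ ψ w) (f : ℝ → ℝ≥0∞) :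
    ∫⁻ t in Ioi 0, f (v t) = ∫⁻ u in Ioo 0 l, f u * (ENNReal.ofReal (ψ u))⁻¹ := by
  rw [← hv.image_Ioi hpos hψ hmono,
    lintegral_image_eq_lintegral_abs_deriv_mul (f' := fun t => -ψ (v t)) measurableSet_Ioi
      (fun t ht => (hv.hasDerivAt ht).hasDerivWithinAt)
      ((hv.strictAntiOn hpos hψ).injOn.mono Ioi_subset_Ici_self)]
  refine setLIntegral_congr_fun measurableSet_Ioi fun t ht => ?_
  have h := hψ _ (hpos t (le_of_lt ht))
  simp only [abs_neg, abs_of_pos h]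
  rw [mul_left_comm, ENNReal.mul_inv_cancel (ENNReal.ofReal_pos.2 h).ne' ENNReal.ofReal_ne_top,
    mul_one]

end IsCumulantSolution

/-! ### Total mass of the potential measure -/

section Potential

variable {Ω : Type*} [MeasurableSpace Ω] {P : Kernel ℝ≥0 Ω} {Z : ℝ≥0 → Ω → ℝ≥0}

theorem iSup_ofReal_one_sub_exp_neg_mul (z : ℝ≥0) :
    ⨆ n : ℕ, ENNReal.ofReal (1 - Real.exp (-((n : ℝ) + 1) * z)) =
      (Ioi (0 : ℝ≥0)).indicator 1 z := by
  refine iSup_eq_of_tendsto (monotone_nat_of_le_succ fun n => ?_) ?_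
  · gcongr
    simp
  · rcases eq_or_lt_of_le (zero_le : 0 ≤ z) with rfl | hz
    · simp
    · have h : Tendsto (fun n : ℕ => -((n : ℝ) + 1) * z) atTop atBot := by
        simp only [neg_mul]
        exact tendsto_neg_atTop_atBot.comp
          ((tendsto_atTop_add_const_right _ _ tendsto_natCast_atTop_atTop).atTop_mul_const
            (NNReal.coe_pos.2 hz))
      simpa [hz] using
        ENNReal.tendsto_ofReal ((Real.tendsto_exp_atBot.comp h).const_sub 1)

/-- Monotone convergence in both integrals, as 1 - e^{-λz} increases to the indicator of z > 0. The
values λ = n + 1 are positive, as the cumulant equation requires. -/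
theorem potentialMeasure_univ (hZ : IsCBProcess P Z) (x : ℝ≥0) :
    potentialMeasure hZ x univ =
      ⨆ n : ℕ, ∫⁻ t in Ioi (0 : ℝ), ∫⁻ ω,
        ENNReal.ofReal (1 - Real.exp (-((n : ℝ) + 1) * Z t.toNNReal ω)) ∂P x := by
  have := hZ.isMarkovKernel
  have h0 : potentialMeasure hZ x univ = potentialMeasure hZ x (Ioi 0) := by
    unfold potentialMeasure
    rw [Measure.restrict_apply MeasurableSet.univ, univ_inter,
      Measure.restrict_apply measurableSet_Ioi, inter_self]
  have hmeas : ∀ n : ℕ, Measurable fun p : ℝ × Ω =>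
      ENNReal.ofReal (1 - Real.exp (-((n : ℝ) + 1) * Z p.1.toNNReal p.2)) := fun n =>
    (((hZ.measurable_uncurry.coe_nnreal_real.const_mul _).exp).const_sub 1).ennreal_ofReal
  have hmono : ∀ t ω, Monotone fun n : ℕ =>
      ENNReal.ofReal (1 - Real.exp (-((n : ℝ) + 1) * Z t ω)) := fun t ω =>
    monotone_nat_of_le_succ fun n => by
      gcongr
      simp
  rw [h0, potentialMeasure_apply hZ x measurableSet_Ioi subset_rfl,
    ← lintegral_iSup (fun n => (hmeas n).lintegral_prod_right')
      (fun m n hmn t => lintegral_mono fun ω => hmono _ ω hmn)]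
  refine lintegral_congr fun t => ?_
  have hZt : Measurable (Z t.toNNReal) := (hZ.stronglyMeasurable _).measurable
  have hsup := lintegral_iSup (μ := P x) (fun n => (hmeas n).comp (measurable_prodMk_left (x := t)))
    (fun m n hmn ω => hmono _ ω hmn)
  refine Eq.trans ?_ hsup
  rw [← lintegral_indicator_one (hZt measurableSet_Ioi)]
  refine lintegral_congr fun ω => ?_
  exact (iSup_ofReal_one_sub_exp_neg_mul _).symm

/-- For λ = n + 1 the substitution u = u_t(λ) gives the integral over (0,n+1), and these intervals
exhaust (0,∞). -/
theorem potentialMeasure_univ_eq {α σ : ℝ} {π : Measure ℝ} (hα : 0 ≤ α)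
    (hπ : IsBranchingLevyMeasure π) (hGrey : GreyCondition (branchingMechanism α σ π))
    (hZ : IsCBProcess P Z) (hψ : HasBranchingMechanism P Z (branchingMechanism α σ π))
    {x : ℝ≥0} (hx : 0 < x) :
    potentialMeasure hZ x univ = ∫⁻ u in Ioi (0 : ℝ),
      ENNReal.ofReal (1 - Real.exp (-x * u)) *
        (ENNReal.ofReal (branchingMechanism α σ π u))⁻¹ := by
  have := hZ.isMarkovKernel
  have hunion : Ioi (0 : ℝ) = ⋃ n : ℕ, Ioo (0 : ℝ) (n + 1) := by
    ext u
    simp only [mem_Ioi, mem_iUnion, mem_Ioo, exists_and_left, iff_self_and]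
    intro _
    obtain ⟨n, hn⟩ := exists_nat_gt u
    exact ⟨n, by linarith⟩
  rw [potentialMeasure_univ, hunion, setLIntegral_iUnion_of_directed _
    (Monotone.directed_le fun m n hmn => Ioo_subset_Ioo_right (by gcongr))]
  refine iSup_congr fun n => ?_
  have hn : (0 : ℝ) < n + 1 := by positivity
  obtain ⟨v, hv, hvZ⟩ := hψ (n + 1) hn
  have hnonneg : ∀ u, 0 ≤ u → 0 ≤ branchingMechanism α σ π u := fun u hu =>
    IsBranchingLevyMeasure.branchingMechanism_nonneg hα hu
  have hpos := fun t => hv.pos (t := t) hn hnonneg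
    fun u hu hul => hπ.branchingMechanism_le_div_mul hu hn hul
  rw [← hv.lintegral_comp hpos (fun u hu => hπ.branchingMechanism_pos hα hGrey hu)
    (fun u w hu huw => hπ.branchingMechanism_mono hα hu.le (hu.trans_le huw) huw)
    (fun u => ENNReal.ofReal (1 - Real.exp (-x * u))), ← hunion]
  refine setLIntegral_congr_fun measurableSet_Ioi fun t ht => ?_
  have hle : ∀ ω, Real.exp (-((n : ℝ) + 1) * Z t.toNNReal ω) ≤ 1 := fun ω => by
    rw [Real.exp_le_one_iff, neg_mul, neg_nonpos]
    positivity
  have hint : Integrable (fun ω => Real.exp (-((n : ℝ) + 1) * Z t.toNNReal ω)) (P x) := by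
    refine Integrable.of_bound (C := 1) ?_ (Eventually.of_forall fun ω => ?_)
    · exact (((hZ.stronglyMeasurable _).measurable.coe_nnreal_real.const_mul
        _).exp).aestronglyMeasurable
    · rw [Real.norm_of_nonneg (Real.exp_pos _).le]
      exact hle ω
  rw [← ofReal_integral_eq_lintegral_ofReal
    (f := fun ω => 1 - Real.exp (-((n : ℝ) + 1) * Z t.toNNReal ω)) ((integrable_const 1).sub hint)
    (Eventually.of_forall fun ω => sub_nonneg.2 (hle ω)),
    integral_sub (integrable_const 1) hint, hvZ x _ hx, Real.coe_toNNReal _ (le_of_lt ht)]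
  simp

end Potential

/-! ### Comparison of integrals and the inversion u = 1/s -/

theorem ENNReal.inv_le_mul_inv_of_le_mul {a b c : ℝ≥0∞} (hc0 : c ≠ 0) (hc : c ≠ ∞)
    (h : a ≤ c * b) : b⁻¹ ≤ c * a⁻¹ := by
  have h1 : c⁻¹ * b⁻¹ ≤ a⁻¹ := by
    rw [← ENNReal.mul_inv (Or.inl hc0) (Or.inl hc)]
    exact ENNReal.inv_le_inv.2 h
  calc b⁻¹ = c * (c⁻¹ * b⁻¹) := by
        rw [← mul_assoc, ENNReal.mul_inv_cancel hc0 hc, one_mul]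
    _ ≤ c * a⁻¹ := by gcongr

theorem setLIntegral_lt_top_of_le_const_mul {s : Set ℝ} (hs : MeasurableSet s) {f g : ℝ → ℝ≥0∞}
    {c : ℝ≥0∞} (hc : c ≠ ∞) (hle : ∀ x ∈ s, g x ≤ c * f x) (hf : ∫⁻ x in s, f x < ∞) :
    ∫⁻ x in s, g x < ∞ := by
  refine (setLIntegral_mono' hs hle).trans_lt ?_
  rw [lintegral_const_mul' _ _ hc]
  exact ENNReal.mul_lt_top hc.lt_top hf

theorem IntegralFiniteAtTop.of_le_const_mul {f g : ℝ → ℝ≥0∞} {c : ℝ≥0∞} (hc : c ≠ ∞)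
    (hle : ∀ x, 0 < x → g x ≤ c * f x) (hf : IntegralFiniteAtTop f) : IntegralFiniteAtTop g := by
  obtain ⟨a, ha, h⟩ := hf
  exact ⟨a, ha, setLIntegral_lt_top_of_le_const_mul measurableSet_Ioi hc
    (fun x hx => hle x (ha.trans hx)) h⟩

theorem lintegral_Ioi_inv_ofReal (a : ℝ) : ∫⁻ s in Ioi a, (ENNReal.ofReal s)⁻¹ = ∞ := by
  by_contra h
  refine not_integrableOn_Ioi_inv (a := max a 0) ⟨by fun_prop, ?_⟩
  rw [hasFiniteIntegral_iff_ofReal]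
  · refine lt_of_le_of_lt ((setLIntegral_mono' measurableSet_Ioi fun s hs => ?_).trans
      (lintegral_mono_set (Ioi_subset_Ioi (le_max_left a 0)))) (Ne.lt_top h)
    rw [ENNReal.ofReal_inv_of_pos ((le_max_right a 0).trans_lt hs)]
  · filter_upwards [ae_restrict_mem measurableSet_Ioi] with s hs
    exact inv_nonneg.2 ((le_max_right a 0).trans (le_of_lt hs))

theorem lintegral_Ioi_inv_ofReal_mul (a : ℝ) {c : ℝ≥0∞} (hc : c ≠ ∞) :
    ∫⁻ s in Ioi a, (ENNReal.ofReal s * c)⁻¹ = ∞ := by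
  refine top_le_iff.1 (le_trans ?_ (setLIntegral_mono' (f := fun s => c⁻¹ * (ENNReal.ofReal s)⁻¹)
    measurableSet_Ioi fun s hs => ?_))
  · rw [lintegral_const_mul _ (by fun_prop), lintegral_Ioi_inv_ofReal,
      ENNReal.mul_top (ENNReal.inv_ne_zero.2 hc)]
  · rw [mul_comm, ENNReal.mul_inv (Or.inr hc) (Or.inl ENNReal.ofReal_ne_top)]

theorem lintegral_Ioo_mul_inv_eq {ψ : ℝ → ℝ} (hψ : ∀ u, 0 < u → 0 < ψ u) {a : ℝ} (ha : 0 < a) :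
    ∫⁻ u in Ioo 0 a⁻¹, ENNReal.ofReal u * (ENNReal.ofReal (ψ u))⁻¹ =
      ∫⁻ s in Ioi a, (ENNReal.ofReal s * ENNReal.ofReal (s ^ 2 * ψ s⁻¹))⁻¹ := by
  have himage : (fun s : ℝ => s⁻¹) '' Ioi a = Ioo 0 a⁻¹ := by
    rw [image_inv_eq_inv, inv_Ioi₀ ha]
  rw [← himage, lintegral_image_eq_lintegral_abs_deriv_mul (f' := fun s => -(s ^ 2)⁻¹)
    measurableSet_Ioi (fun s hs => (hasDerivAt_inv (ha.trans hs).ne').hasDerivWithinAt)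
    inv_injective.injOn]
  refine setLIntegral_congr_fun measurableSet_Ioi fun s hs => ?_
  have hs : 0 < s := ha.trans hs
  have h := hψ _ (inv_pos.2 hs)
  simp only [abs_neg]
  rw [abs_of_pos (by positivity), ← ENNReal.ofReal_mul hs.le, ← ENNReal.ofReal_inv_of_pos h,
    ← ENNReal.ofReal_inv_of_pos (by positivity), ← ENNReal.ofReal_mul (by positivity),
    ← ENNReal.ofReal_mul (by positivity)]
  congr 1
  rw [mul_inv, mul_inv]
  ring

/-- The truncated moment `∫ (r² ∧ s r) π(dr)`. -/
noncomputable def truncatedMoment (π : Measure ℝ) (s : ℝ) : ℝ≥0∞ :=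
  ∫⁻ r, ENNReal.ofReal (min (r ^ 2) (s * r)) ∂π

/-! ### The truncated moment M(s) and its comparisons -/

namespace IsBranchingLevyMeasure

variable {π : Measure ℝ} {α σ : ℝ}

theorem truncatedMoment_one_ne_top (hπ : IsBranchingLevyMeasure π) : truncatedMoment π 1 ≠ ∞ := by
  have := hπ.moment.ne
  rw [hπ.restrict_Ioi] at this
  simpa only [truncatedMoment, one_mul, min_comm] using this

theorem truncatedMoment_mono (hπ : IsBranchingLevyMeasure π) {s t : ℝ} (hst : s ≤ t) :
    truncatedMoment π s ≤ truncatedMoment π t := by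
  refine lintegral_mono_ae ?_
  filter_upwards [hπ.ae_pos] with r hr
  gcongr

/-- Used for the degenerate case: if M(1) = 0, then M vanishes on [1,∞). -/
theorem truncatedMoment_le_mul (hπ : IsBranchingLevyMeasure π) {s : ℝ} (hs : 1 ≤ s) :
    truncatedMoment π s ≤ ENNReal.ofReal s * truncatedMoment π 1 := by
  unfold truncatedMoment
  rw [← lintegral_const_mul' _ _ ENNReal.ofReal_ne_top]
  refine lintegral_mono_ae ?_
  filter_upwards [hπ.ae_pos] with r hr
  rw [← ENNReal.ofReal_mul (by positivity), mul_min_of_nonneg _ _ (by positivity), one_mul]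
  gcongr
  exact le_mul_of_one_le_left (sq_nonneg r) hs

theorem ofReal_sq_mul_integral (hπ : IsBranchingLevyMeasure π) {s : ℝ} (hs : 0 < s) :
    ENNReal.ofReal (s ^ 2 * ∫ r in Ioi (0 : ℝ), (Real.exp (-s⁻¹ * r) - 1 + s⁻¹ * r) ∂π) =
      ∫⁻ r, ENNReal.ofReal (s ^ 2 * (Real.exp (-(s⁻¹ * r)) - 1 + s⁻¹ * r)) ∂π := by
  have hint := (hπ.integrable_exp (inv_nonneg.2 hs.le)).const_mul (s ^ 2)
  rw [← integral_const_mul, ofReal_integral_eq_lintegral_ofReal hint, hπ.restrict_Ioi]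
  · simp only [neg_mul]
  · refine Eventually.of_forall fun r => ?_
    simp only [neg_mul]
    exact mul_nonneg (sq_nonneg s) (exp_neg_sub_one_add_nonneg _)

theorem sq_mul_min_inv_mul {s : ℝ} (hs : 0 < s) (r : ℝ) :
    s ^ 2 * min (s⁻¹ * r) ((s⁻¹ * r) ^ 2) = min (r ^ 2) (s * r) := by
  rw [mul_min_of_nonneg _ _ (sq_nonneg s), min_comm]
  congr 1 <;> field_simp

theorem truncatedMoment_le (hπ : IsBranchingLevyMeasure π) (hα : 0 ≤ α) {s : ℝ} (hs : 0 < s) :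
    truncatedMoment π s ≤ 4 * ENNReal.ofReal (s ^ 2 * branchingMechanism α σ π s⁻¹) := by
  calc truncatedMoment π s
      ≤ ∫⁻ r, 4 * ENNReal.ofReal (s ^ 2 * (Real.exp (-(s⁻¹ * r)) - 1 + s⁻¹ * r)) ∂π := by
        refine lintegral_mono fun r => ?_
        rw [← ENNReal.ofReal_ofNat, ← ENNReal.ofReal_mul (by norm_num),
          ← sq_mul_min_inv_mul hs, mul_left_comm]
        gcongr
        exact min_le_exp_neg_sub_one_add _
    _ ≤ _ := by
        rw [lintegral_const_mul' _ _ (by norm_num), ← hπ.ofReal_sq_mul_integral hs]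
        gcongr
        unfold branchingMechanism
        have : 0 ≤ α * s⁻¹ + σ ^ 2 * s⁻¹ ^ 2 / 2 := by positivity
        linarith

theorem ofReal_sq_mul_branchingMechanism_le (hπ : IsBranchingLevyMeasure π) {s : ℝ}
    (hs : 0 < s) :
    ENNReal.ofReal (s ^ 2 * branchingMechanism 0 σ π s⁻¹) ≤
      ENNReal.ofReal (σ ^ 2 / 2) + truncatedMoment π s := by
  have h : s ^ 2 * branchingMechanism 0 σ π s⁻¹ = σ ^ 2 / 2 +
      s ^ 2 * ∫ r in Ioi (0 : ℝ), (Real.exp (-s⁻¹ * r) - 1 + s⁻¹ * r) ∂π := by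
    unfold branchingMechanism
    field_simp
    ring
  rw [h]
  refine ENNReal.ofReal_add_le.trans ?_
  rw [hπ.ofReal_sq_mul_integral hs]
  gcongr
  refine lintegral_mono_ae ?_
  filter_upwards [hπ.ae_pos] with r hr
  rw [← sq_mul_min_inv_mul hs]
  gcongr
  exact exp_neg_sub_one_add_le_min (by positivity)

theorem ofReal_mul_truncatedMoment (hπ : IsBranchingLevyMeasure π) {s : ℝ} (hs : 0 < s) :
    ENNReal.ofReal s * truncatedMoment π s =
      ENNReal.ofReal s * ∫⁻ r in Ioc 0 s, ENNReal.ofReal (r ^ 2) ∂π +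
        ENNReal.ofReal (s ^ 2) * ∫⁻ r in Ioi s, ENNReal.ofReal r ∂π := by
  have h1 : truncatedMoment π s = ∫⁻ r in Ioc 0 s, ENNReal.ofReal (r ^ 2) ∂π +
      ENNReal.ofReal s * ∫⁻ r in Ioi s, ENNReal.ofReal r ∂π := by
    rw [truncatedMoment, ← hπ.restrict_Ioi, ← Ioc_union_Ioi_eq_Ioi hs.le,
      lintegral_union measurableSet_Ioi (Ioc_disjoint_Ioi le_rfl), Ioc_union_Ioi_eq_Ioi hs.le,
      hπ.restrict_Ioi, ← lintegral_const_mul' _ _ ENNReal.ofReal_ne_top]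
    congr 1
    · refine setLIntegral_congr_fun measurableSet_Ioc fun r hr => ?_
      rw [min_eq_left (by nlinarith [hr.1, hr.2])]
    · refine setLIntegral_congr_fun measurableSet_Ioi fun r hr => ?_
      have hr : s < r := hr
      rw [min_eq_right (by nlinarith), ENNReal.ofReal_mul hs.le]
  rw [h1, mul_add, ← mul_assoc, ← ENNReal.ofReal_mul hs.le, ← sq]

/-- Tonelli on the region r < y < z. -/
theorem levyIntegratedTail_eq (hπ : IsBranchingLevyMeasure π) (r : ℝ) :
    levyIntegratedTail π r = ∫⁻ z, ENNReal.ofReal (z - r) ∂π := by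
  have := hπ.sigmaFinite
  have hm : Measurable (Function.uncurry fun y z : ℝ => (Ioi y).indicator (1 : ℝ → ℝ≥0∞) z) := by
    have : (Function.uncurry fun y z : ℝ => (Ioi y).indicator (1 : ℝ → ℝ≥0∞) z) =
        {p : ℝ × ℝ | p.1 < p.2}.indicator 1 := by
      ext p
      simp [indicator, Function.uncurry]
    rw [this]
    exact measurable_one.indicator (measurableSet_lt measurable_fst measurable_snd)
  calc levyIntegratedTail π r = ∫⁻ y in Ioi r, ∫⁻ z, (Ioi y).indicator 1 z ∂π := by
        simp only [levyIntegratedTail, levyTail, lintegral_indicator_one measurableSet_Ioi]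
    _ = ∫⁻ z, (∫⁻ y in Ioi r, (Ioi y).indicator 1 z) ∂π :=
        lintegral_lintegral_swap hm.aemeasurable
    _ = ∫⁻ z, ENNReal.ofReal (z - r) ∂π := by
        refine lintegral_congr fun z => ?_
        have : (fun y : ℝ => (Ioi y).indicator (1 : ℝ → ℝ≥0∞) z) = (Iio z).indicator 1 := by
          ext y
          simp [indicator]
        rw [this, lintegral_indicator_one measurableSet_Iio,
          Measure.restrict_apply measurableSet_Iio, inter_comm, Ioi_inter_Iio, Real.volume_Ioo]

theorem setLIntegral_levyIntegratedTail (hπ : IsBranchingLevyMeasure π) (s : ℝ) :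
    ∫⁻ r in Ioc 0 s, levyIntegratedTail π r =
      ∫⁻ z, (∫⁻ r in Ioc 0 s, ENNReal.ofReal (z - r)) ∂π := by
  have := hπ.sigmaFinite
  simp only [hπ.levyIntegratedTail_eq]
  exact lintegral_lintegral_swap (by fun_prop)

theorem setLIntegral_levyIntegratedTail_le (hπ : IsBranchingLevyMeasure π) (s : ℝ) :
    ∫⁻ r in Ioc 0 s, levyIntegratedTail π r ≤ truncatedMoment π s := by
  rw [hπ.setLIntegral_levyIntegratedTail]
  refine lintegral_mono_ae ?_
  filter_upwards [hπ.ae_pos] with z hz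
  -- For r > 0, (z - r)⁺ is at most z and vanishes beyond z, so the integral is at most z·(z ∧ s).
  calc ∫⁻ r in Ioc 0 s, ENNReal.ofReal (z - r)
      ≤ ∫⁻ r in Ioc 0 s, (Ioc 0 z).indicator (fun _ => ENNReal.ofReal z) r := by
        refine setLIntegral_mono' measurableSet_Ioc fun r hr => ?_
        by_cases hrz : r ≤ z
        · rw [indicator_of_mem (show r ∈ Ioc 0 z from ⟨hr.1, hrz⟩)]
          gcongr
          linarith [hr.1]
        · rw [ENNReal.ofReal_of_nonpos (by linarith)]
          exact zero_le
    _ = ENNReal.ofReal (min (z ^ 2) (s * z)) := by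
        rw [lintegral_indicator_const measurableSet_Ioc,
          Measure.restrict_apply measurableSet_Ioc, Ioc_inter_Ioc, Real.volume_Ioc,
          ← ENNReal.ofReal_mul hz.le, sup_idem, sub_zero, mul_min_of_nonneg _ _ hz.le, ← sq,
          mul_comm]

/-- On 0 < r ≤ (z ∧ s)/2 one has z - r ≥ z/2, which already contributes z(z ∧ s)/4. -/
theorem truncatedMoment_le_setLIntegral (hπ : IsBranchingLevyMeasure π) (s : ℝ) :
    truncatedMoment π s ≤ 4 * ∫⁻ r in Ioc 0 s, levyIntegratedTail π r := by
  rw [hπ.setLIntegral_levyIntegratedTail, truncatedMoment,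
    ← lintegral_const_mul' _ _ (by norm_num)]
  refine lintegral_mono_ae ?_
  filter_upwards [hπ.ae_pos] with z hz
  rcases le_or_gt s 0 with hs | hs
  · rw [ENNReal.ofReal_of_nonpos ((min_le_right _ _).trans
      (mul_nonpos_of_nonpos_of_nonneg hs hz.le))]
    exact zero_le
  have hm : 0 < min z s := lt_min hz hs
  calc ENNReal.ofReal (min (z ^ 2) (s * z))
      = 4 * ∫⁻ _ in Ioc 0 (min z s / 2), ENNReal.ofReal (z / 2) := by
        rw [setLIntegral_const, Real.volume_Ioc, ← ENNReal.ofReal_mul (by positivity),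
          ← ENNReal.ofReal_ofNat, ← ENNReal.ofReal_mul (by norm_num)]
        congr 1
        rw [show (4 : ℝ) * (z / 2 * (min z s / 2 - 0)) = z * min z s by ring,
          mul_min_of_nonneg _ _ hz.le, sq, mul_comm s]
    _ ≤ 4 * ∫⁻ r in Ioc 0 (min z s / 2), ENNReal.ofReal (z - r) := by
        gcongr 4 * ?_
        refine setLIntegral_mono' measurableSet_Ioc fun r hr => ?_
        gcongr
        linarith [hr.2, min_le_left z s]
    _ ≤ _ := by
        gcongr
        linarith [min_le_right z s]

end IsBranchingLevyMeasure

/-! ### Reduction to the behaviour of u/ψ(u) near 0 -/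

theorem GreyCondition.lintegral_lt_top_iff {α σ : ℝ} {π : Measure ℝ} (hα : 0 ≤ α)
    (hπ : IsBranchingLevyMeasure π) (hGrey : GreyCondition (branchingMechanism α σ π))
    {x : ℝ} (hx : 0 < x) {c : ℝ} (hc : 0 < c) :
    ∫⁻ u in Ioi (0 : ℝ), ENNReal.ofReal (1 - Real.exp (-x * u)) *
        (ENNReal.ofReal (branchingMechanism α σ π u))⁻¹ < ∞ ↔
      ∫⁻ u in Ioo (0 : ℝ) c,
        ENNReal.ofReal u * (ENNReal.ofReal (branchingMechanism α σ π u))⁻¹ < ∞ := by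
  constructor
  · intro h
    -- The constant comes from xu ≤ e^{xu}(1 - e^{-xu}) together with u < c.
    refine setLIntegral_lt_top_of_le_const_mul measurableSet_Ioo
      (c := ENNReal.ofReal (Real.exp (x * c) / x)) ENNReal.ofReal_ne_top (fun u hu => ?_)
      ((lintegral_mono_set Ioo_subset_Ioi_self).trans_lt h)
    rw [← mul_assoc, ← ENNReal.ofReal_mul (by positivity)]
    gcongr
    have h1 : Real.exp (-x * u) * (x * u + 1) ≤ 1 := by
      calc Real.exp (-x * u) * (x * u + 1) ≤ Real.exp (-x * u) * Real.exp (x * u) := by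
            gcongr; exact Real.add_one_le_exp _
        _ = 1 := by rw [← Real.exp_add]; simp
    have h2 : 1 ≤ Real.exp (x * c) * Real.exp (-x * u) := by
      rw [← Real.exp_add, Real.one_le_exp_iff]
      nlinarith [hu.2]
    have h3 : x * u ≤ Real.exp (x * c) * (1 - Real.exp (-x * u)) := by
      have hxu : 0 < x * u := mul_pos hx hu.1
      nlinarith [Real.exp_pos (x * c)]
    rw [div_mul_eq_mul_div, le_div_iff₀ hx, mul_comm u]
    exact h3
  · intro h
    obtain ⟨a, ha, hfin⟩ := hGrey
    -- Near 0 use 1 - e^{-xu} ≤ xu, in the middle monotonicity of ψ, beyond a Grey's condition. If a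
    -- < c the middle piece is empty and the outer ones overlap, which is harmless.
    have hcover : Ioi (0 : ℝ) ⊆ Ioo 0 c ∪ (Icc c a ∪ Ioi a) := by
      intro u hu
      rcases lt_or_ge u c with h1 | h1
      · exact Or.inl ⟨hu, h1⟩
      · rcases le_or_gt u a with h2 | h2
        · exact Or.inr (Or.inl ⟨h1, h2⟩)
        · exact Or.inr (Or.inr h2)
    have hone : ∀ u, ENNReal.ofReal (1 - Real.exp (-x * u)) ≤ 1 := fun u => by
      rw [ENNReal.ofReal_le_one]
      linarith [Real.exp_pos (-x * u)]
    refine ((lintegral_mono_set hcover).trans ((lintegral_union_le _ _ _).trans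
      (add_le_add_right (lintegral_union_le _ _ _) _))).trans_lt
      (ENNReal.add_lt_top.2 ⟨?_, ENNReal.add_lt_top.2 ⟨?_, ?_⟩⟩)
    · refine setLIntegral_lt_top_of_le_const_mul measurableSet_Ioo
        (c := ENNReal.ofReal x) ENNReal.ofReal_ne_top (fun u hu => ?_) h
      rw [← mul_assoc, ← ENNReal.ofReal_mul hx.le]
      gcongr
      linarith [Real.add_one_le_exp (-x * u)]
    · refine setLIntegral_lt_top_of_le_const_mul measurableSet_Icc (f := fun _ => 1)
        (c := (ENNReal.ofReal (branchingMechanism α σ π c))⁻¹) ?_ (fun u hu => ?_) (by simp)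
      · exact ENNReal.inv_ne_top.2
          (ENNReal.ofReal_pos.2 (hπ.branchingMechanism_pos hα ⟨a, ha, hfin⟩ hc)).ne'
      · rw [mul_one]
        refine (mul_le_mul_left (hone u) _).trans ?_
        rw [one_mul]
        exact ENNReal.inv_le_inv.2 (ENNReal.ofReal_le_ofReal
          (hπ.branchingMechanism_mono hα hc.le (hc.trans_le hu.1) hu.1))
    · exact setLIntegral_lt_top_of_le_const_mul measurableSet_Ioi ENNReal.one_ne_top
        (fun u _ => mul_le_mul_left (hone u) _) hfin

theorem isFiniteMeasure_potentialMeasure_iff {Ω : Type*} [MeasurableSpace Ω] {P : Kernel ℝ≥0 Ω}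
    {Z : ℝ≥0 → Ω → ℝ≥0} {α σ : ℝ} {π : Measure ℝ} (hα : 0 ≤ α)
    (hπ : IsBranchingLevyMeasure π) (hGrey : GreyCondition (branchingMechanism α σ π))
    (hZ : IsCBProcess P Z) (hψ : HasBranchingMechanism P Z (branchingMechanism α σ π))
    {x : ℝ≥0} (hx : 0 < x) {c : ℝ} (hc : 0 < c) :
    IsFiniteMeasure (potentialMeasure hZ x) ↔
      ∫⁻ u in Ioo (0 : ℝ) c,
        ENNReal.ofReal u * (ENNReal.ofReal (branchingMechanism α σ π u))⁻¹ < ∞ := by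
  rw [isFiniteMeasure_iff, potentialMeasure_univ_eq hα hπ hGrey hZ hψ hx,
    hGrey.lintegral_lt_top_iff hα hπ (NNReal.coe_pos.2 hx) hc]

/-! ### Integral tests for α > 0 and α = 0 -/

namespace IsBranchingLevyMeasure

variable {π : Measure ℝ} {α σ : ℝ}

theorem lintegral_mul_inv_lt_top_of_pos (hα : 0 < α) (c : ℝ) :
    ∫⁻ u in Ioo (0 : ℝ) c,
      ENNReal.ofReal u * (ENNReal.ofReal (branchingMechanism α σ π u))⁻¹ < ∞ := by
  refine setLIntegral_lt_top_of_le_const_mul measurableSet_Ioo (f := fun _ => 1)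
    (c := (ENNReal.ofReal α)⁻¹) (ENNReal.inv_ne_top.2 (ENNReal.ofReal_pos.2 hα).ne')
    (fun u hu => ?_) (by simp)
  have hu0 := (ENNReal.ofReal_pos.2 hu.1).ne'
  calc ENNReal.ofReal u * (ENNReal.ofReal (branchingMechanism α σ π u))⁻¹
      ≤ ENNReal.ofReal u * (ENNReal.ofReal (α * u))⁻¹ := by
        gcongr
        exact mul_le_branchingMechanism
    _ = (ENNReal.ofReal α)⁻¹ * 1 := by
        rw [ENNReal.ofReal_mul hα.le, ENNReal.mul_inv (Or.inr ENNReal.ofReal_ne_top)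
          (Or.inr hu0), mul_left_comm, ENNReal.mul_inv_cancel hu0 ENNReal.ofReal_ne_top]

theorem integralFiniteAtTop_of_lintegral_lt_top (hπ : IsBranchingLevyMeasure π)
    (hpos : ∀ u, 0 < u → 0 < branchingMechanism 0 σ π u)
    (h : ∫⁻ u in Ioo (0 : ℝ) 1,
      ENNReal.ofReal u * (ENNReal.ofReal (branchingMechanism 0 σ π u))⁻¹ < ∞) :
    IntegralFiniteAtTop fun s => (ENNReal.ofReal s * truncatedMoment π s)⁻¹ := by
  rw [← inv_one, lintegral_Ioo_mul_inv_eq hpos one_pos] at h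
  -- If M(1) = 0 only the term σ²/2 remains and the integral dominates a harmonic one (or is
  -- infinite when σ = 0), contradicting `h`. Otherwise σ²/2 ≤ (σ²/2)/M(1) · M(s) for s > 1.
  by_cases h1 : truncatedMoment π 1 = 0
  · refine absurd h (not_lt.2 ?_)
    rw [← lintegral_Ioi_inv_ofReal_mul 1
      (ENNReal.ofReal_ne_top (r := σ ^ 2 / 2))]
    refine setLIntegral_mono' measurableSet_Ioi fun s hs => ?_
    have hs : 1 < s := hs
    gcongr (ENNReal.ofReal s * ?_)⁻¹
    have := hπ.truncatedMoment_le_mul hs.le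
    rw [h1, mul_zero, nonpos_iff_eq_zero] at this
    simpa only [this, add_zero] using
      hπ.ofReal_sq_mul_branchingMechanism_le (σ := σ) (one_pos.trans hs)
  · refine ⟨1, one_pos, setLIntegral_lt_top_of_le_const_mul measurableSet_Ioi
      (c := ENNReal.ofReal (σ ^ 2 / 2) / truncatedMoment π 1 + 1) ?_ (fun s hs => ?_) h⟩
    · exact ENNReal.add_ne_top.2
        ⟨(ENNReal.div_lt_top ENNReal.ofReal_ne_top h1).ne, ENNReal.one_ne_top⟩
    · have hs : 1 < s := hs
      refine ENNReal.inv_le_mul_inv_of_le_mul (by simp) (ENNReal.add_ne_top.2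
        ⟨(ENNReal.div_lt_top ENNReal.ofReal_ne_top h1).ne, ENNReal.one_ne_top⟩) ?_
      rw [mul_left_comm]
      gcongr
      refine (hπ.ofReal_sq_mul_branchingMechanism_le (one_pos.trans hs)).trans ?_
      rw [add_mul, one_mul]
      gcongr
      calc ENNReal.ofReal (σ ^ 2 / 2)
          = ENNReal.ofReal (σ ^ 2 / 2) / truncatedMoment π 1 * truncatedMoment π 1 :=
            (ENNReal.div_mul_cancel h1 hπ.truncatedMoment_one_ne_top).symm
        _ ≤ _ := by gcongr; exact hπ.truncatedMoment_mono hs.le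

/-- The cutoff is inherited as c = 1/a from the integral at infinity; its value does not matter,
since `isFiniteMeasure_potentialMeasure_iff` holds for every c > 0. -/
theorem lintegral_lt_top_of_integralFiniteAtTop (hπ : IsBranchingLevyMeasure π)
    (hpos : ∀ u, 0 < u → 0 < branchingMechanism 0 σ π u)
    (h : IntegralFiniteAtTop fun s => (ENNReal.ofReal s * truncatedMoment π s)⁻¹) :
    ∃ c : ℝ, 0 < c ∧ ∫⁻ u in Ioo (0 : ℝ) c,
      ENNReal.ofReal u * (ENNReal.ofReal (branchingMechanism 0 σ π u))⁻¹ < ∞ := by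
  obtain ⟨a, ha, hfin⟩ := h
  refine ⟨a⁻¹, inv_pos.2 ha, ?_⟩
  rw [lintegral_Ioo_mul_inv_eq hpos ha]
  refine setLIntegral_lt_top_of_le_const_mul measurableSet_Ioi (c := 4) (by norm_num)
    (fun s hs => ?_) hfin
  refine ENNReal.inv_le_mul_inv_of_le_mul (by norm_num) (by norm_num) ?_
  rw [mul_left_comm]
  gcongr
  exact hπ.truncatedMoment_le le_rfl (ha.trans hs)

end IsBranchingLevyMeasure

theorem mainTheorem10 {Ω : Type*} [MeasurableSpace Ω]
    (α σ : ℝ) (π : Measure ℝ) (hα : 0 ≤ α) (hσ : 0 ≤ σ) (hπ : IsBranchingLevyMeasure π)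
    (hGrey : GreyCondition (branchingMechanism α σ π))
    (P : Kernel ℝ≥0 Ω) (Z : ℝ≥0 → Ω → ℝ≥0) (hZ : IsCBProcess P Z)
    (hψ : HasBranchingMechanism P Z (branchingMechanism α σ π)) :
    (0 < α → ∀ x : ℝ≥0, 0 < x → IsFiniteMeasure (potentialMeasure hZ x)) ∧
    (α = 0 → List.TFAE [
      ∃ x : ℝ≥0, 0 < x ∧ IsFiniteMeasure (potentialMeasure hZ x),
      ∀ x : ℝ≥0, 0 < x → IsFiniteMeasure (potentialMeasure hZ x),
      IntegralFiniteAtTop fun s =>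
        (ENNReal.ofReal s * ∫⁻ r in Ioc 0 s, levyIntegratedTail π r)⁻¹,
      IntegralFiniteAtTop fun s =>
        (ENNReal.ofReal s * ∫⁻ r in Ioc 0 s, ENNReal.ofReal (r ^ 2) ∂π +
          ENNReal.ofReal (s ^ 2) * ∫⁻ r in Ioi s, ENNReal.ofReal r ∂π)⁻¹]) := by
  refine ⟨fun hα0 x hx => (isFiniteMeasure_potentialMeasure_iff hα hπ hGrey hZ hψ hx one_pos).2
    (IsBranchingLevyMeasure.lintegral_mul_inv_lt_top_of_pos hα0 1), ?_⟩
  rintro rfl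
  have hpos : ∀ u, 0 < u → 0 < branchingMechanism 0 σ π u := fun u hu =>
    hπ.branchingMechanism_pos hα hGrey hu
  tfae_have 2 → 1 := fun h => ⟨1, one_pos, h 1 one_pos⟩
  tfae_have 1 → 4 := by
    rintro ⟨x, hx, hfin⟩
    refine IntegralFiniteAtTop.of_le_const_mul ENNReal.one_ne_top (fun s hs => ?_)
      (hπ.integralFiniteAtTop_of_lintegral_lt_top hpos
        ((isFiniteMeasure_potentialMeasure_iff hα hπ hGrey hZ hψ hx one_pos).1 hfin))
    rw [one_mul, hπ.ofReal_mul_truncatedMoment hs]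
  tfae_have 4 → 3 := by
    refine IntegralFiniteAtTop.of_le_const_mul (c := 4) (by norm_num) fun s hs => ?_
    rw [← hπ.ofReal_mul_truncatedMoment hs]
    refine ENNReal.inv_le_mul_inv_of_le_mul (by norm_num) (by norm_num) ?_
    rw [mul_left_comm]
    gcongr
    exact hπ.truncatedMoment_le_setLIntegral s
  tfae_have 3 → 2 := by
    intro h x hx
    have h' : IntegralFiniteAtTop fun s => (ENNReal.ofReal s * truncatedMoment π s)⁻¹ := by
      refine IntegralFiniteAtTop.of_le_const_mul ENNReal.one_ne_top (fun s _ => ?_) h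
      rw [one_mul]
      gcongr
      exact hπ.setLIntegral_levyIntegratedTail_le s
    obtain ⟨c, hc, hfin⟩ := hπ.lintegral_lt_top_of_integralFiniteAtTop hpos h'
    exact (isFiniteMeasure_potentialMeasure_iff hα hπ hGrey hZ hψ hx hc).2 hfin
  tfae_finish
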